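/- Let $f:\mathbb{R}^D\to\mathbb{R}$ be a continuous function of effective dimensionality $d_e\le d$ with effective subspace $\mathcal{T}$; that is, $\mathcal{T}\subseteq\mathbb{R}^D$ is a linear subspace of dimension $d_e$ with $f(x+v)=f(x)$ for all $x\in\mathcal{T}$ and $v\in\mathcal{T}^{\perp}$, and no linear subspace of smaller dimension has this property. Let $x^*$ be a global minimizer of $f$ over $\mathbb{R}^D$ whose orthogonal projection $x_\top^*$ onto $\mathcal{T}$ is non-zero, and let $\mathcal{G}^*=x_\top^*+\mathcal{T}^{\perp}$. Let $A$ be a $D\times d$ Gaussian matrix, i.e. a random matrix whose entries are independent standard normal random variables. Then, with probability one, the set $\{y\in\mathbb{R}^d: Ay\in\mathcal{G}^*\}$ has a unique element $y_2^*$ of minimal Euclidean norm, and $$\frac{\|x_\top^*\|_2^2}{\|y_2^*\|_2^2}\sim\chi^2_{d-d_e+1},$$ where $\chi^2_n$ denotes the law of $Z_1^2+\dots+Z_n^2$ for independent standard normal random variables $Z_1,\dots,Z_n$. In particular, this law depends only on $d-d_e$ and not on $D$. -/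

import Mathlib

open MeasureTheory ProbabilityTheory

noncomputable section

namespace RandomEmbedding

/-- `f` does not vary along `Tᗮ`: `f (x + v) = f x` for all `x ∈ T` and `v ∈ Tᗮ`. -/
def VariesOnlyAlong {D : ℕ} (f : EuclideanSpace ℝ (Fin D) → ℝ)
    (T : Submodule ℝ (EuclideanSpace ℝ (Fin D))) : Prop :=
  ∀ x ∈ T, ∀ v ∈ Tᗮ, f (x + v) = f x

/-- `f` has effective dimensionality `de`, with effective subspace `T` (and constant subspace
`Tᗮ`): `T` has dimension `de`, `f` varies only along `T`, and no subspace of smaller dimension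
has this property. -/
structure HasEffectiveSubspace {D : ℕ} (f : EuclideanSpace ℝ (Fin D) → ℝ) (de : ℕ)
    (T : Submodule ℝ (EuclideanSpace ℝ (Fin D))) : Prop where
  finrank_eq : Module.finrank ℝ T = de
  variesOnlyAlong : VariesOnlyAlong f T
  minimal : ∀ T' : Submodule ℝ (EuclideanSpace ℝ (Fin D)),
    VariesOnlyAlong f T' → de ≤ Module.finrank ℝ T'

/-- A Gaussian matrix: the entries are independent standard normal random variables. -/
structure IsGaussianMatrix {Ω : Type*} [MeasurableSpace Ω] (P : Measure Ω) {D d : ℕ}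
    (A : Ω → Matrix (Fin D) (Fin d) ℝ) : Prop where
  hasLaw_entry : ∀ i j, HasLaw (fun ω => A ω i j) (gaussianReal 0 1) P
  iIndepFun_entries : iIndepFun (fun (p : Fin D × Fin d) (ω : Ω) => A ω p.1 p.2) P

/-- The chi-squared distribution with `n` degrees of freedom: the law of `Z₁² + ⋯ + Zₙ²` for
independent standard normal `Z₁, …, Zₙ`. -/
def chiSquared (n : ℕ) : Measure ℝ :=
  (Measure.pi fun _ : Fin n => gaussianReal 0 1).map (fun z => ∑ i, z i ^ 2)

/-- The component `x_⊤` of `x` in `T`, i.e. its orthogonal projection onto `T`. -/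
def topComponent {D : ℕ} (T : Submodule ℝ (EuclideanSpace ℝ (Fin D)))
    (x : EuclideanSpace ℝ (Fin D)) : EuclideanSpace ℝ (Fin D) :=
  T.starProjection x

/-- The affine subspace `x_⊤ + Tᗮ`. -/
def affineComponent {D : ℕ} (T : Submodule ℝ (EuclideanSpace ℝ (Fin D)))
    (x : EuclideanSpace ℝ (Fin D)) : Set (EuclideanSpace ℝ (Fin D)) :=
  {u | ∃ v ∈ Tᗮ, u = topComponent T x + v}

/-- The set of reduced points `y` with `A y ∈ G`. -/
def reducedSolutions {D d : ℕ} (A : Matrix (Fin D) (Fin d) ℝ)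
    (G : Set (EuclideanSpace ℝ (Fin D))) : Set (EuclideanSpace ℝ (Fin d)) :=
  {y | Matrix.toEuclideanLin A y ∈ G}

/-- `y` is a point of minimal Euclidean norm in `S`. -/
def IsMinNormIn {d : ℕ} (S : Set (EuclideanSpace ℝ (Fin d)))
    (y : EuclideanSpace ℝ (Fin d)) : Prop :=
  y ∈ S ∧ ∀ w ∈ S, ‖y‖ ≤ ‖w‖

end RandomEmbedding

end

noncomputable section

open MeasureTheory ProbabilityTheory WithLp
open scoped RealInnerProductSpace

namespace RandomEmbedding

/-! Take an orthonormal basis `v 0, …, v n` of `T` (so `de = n + 1`) whose first vector points along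
the projected minimizer, of norm `c`. Put `b = Aᵀ v 0` and let `K` be the span of the other `Aᵀ v
i`. Moving `A` across the inner product, `A y` lies in the affine subspace iff `⟪b, y⟫ = c` and `y ∈
Kᗮ`. With `p` the projection of `b` onto `Kᗮ`, the least-norm solution is `(c / ‖p‖²) p`, so the
ratio is `‖p‖²`, the squared distance from `b` to `K` (`isMinNormIn_iff`). By rotation invariance
the `Aᵀ v i` are independent standard Gaussian vectors
(`IsGaussianMatrix.hasLaw_transpose_orthonormal`). Almost surely `b ∉ K` and `dim K = n`; given `K`,
the squared distance is chi-squared with `d - n = d - de + 1` degrees of freedom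
(`hasLaw_sq_infDist_span`). -/

lemma span_range_ne_top {E : Type*} [AddCommGroup E] [Module ℝ E] {n : ℕ}
    (h : n < Module.finrank ℝ E) (w : Fin n → E) :
    Submodule.span ℝ (Set.range w) ≠ ⊤ := by
  intro ht
  have := finrank_range_le_card (R := ℝ) w
  rw [Set.finrank, ht, finrank_top, Fintype.card_fin] at this
  omega

lemma infDist_eq_norm_starProjection_orthogonal {E : Type*} [NormedAddCommGroup E]
    [InnerProductSpace ℝ E] (K : Submodule ℝ E) [K.HasOrthogonalProjection] (x : E) :
    Metric.infDist x K = ‖Kᗮ.starProjection x‖ := by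
  rw [Metric.infDist_eq_iInf, Submodule.starProjection_orthogonal_val,
    Submodule.starProjection_minimal]
  simp [dist_eq_norm]

lemma ae_prod_of_ae_ae_symm {α β : Type*} [MeasurableSpace α] [MeasurableSpace β] {μ : Measure α}
    {ν : Measure β} [SFinite μ] [SFinite ν] {s : Set (α × β)} (hs : MeasurableSet s)
    (h : ∀ᵐ b ∂ν, ∀ᵐ a ∂μ, (a, b) ∈ s) : ∀ᵐ z ∂(μ.prod ν), z ∈ s := by
  rw [ae_iff, ← Set.compl_def, Measure.prod_apply_symm hs.compl,
    lintegral_eq_zero_iff (measurable_measure_prodMk_right hs.compl)]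
  filter_upwards [h] with b hb
  exact ae_iff.1 hb

/-! ### Standard Gaussian vectors and their distance to a random span. -/

section StdGaussian

variable {E F : Type*} [NormedAddCommGroup E] [InnerProductSpace ℝ E] [FiniteDimensional ℝ E]
  [MeasurableSpace E] [BorelSpace E] [NormedAddCommGroup F] [InnerProductSpace ℝ F]
  [FiniteDimensional ℝ F] [MeasurableSpace F] [BorelSpace F]

/-- A map whose adjoint is isometric sends the standard Gaussian to the standard Gaussian. -/
lemma stdGaussian_map_of_adjoint_isometry {L : E → F} (hL : Measurable L) {M : F → E}
    (hLM : ∀ x t, ⟪L x, t⟫ = ⟪x, M t⟫) (hM : ∀ t, ‖M t‖ = ‖t‖) :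
    (stdGaussian E).map L = stdGaussian F := by
  have := Measure.isProbabilityMeasure_map (μ := stdGaussian E) hL.aemeasurable
  refine Measure.ext_of_charFun (funext fun t => ?_)
  rw [charFun_stdGaussian, ← hM t, ← charFun_stdGaussian, charFun_apply, charFun_apply,
    integral_map hL.aemeasurable (Measurable.aestronglyMeasurable (by fun_prop))]
  simp only [hLM]

lemma map_pi_stdGaussian {ι : Type*} [Fintype ι] :
    (Measure.pi fun _ : ι => stdGaussian E).map (toLp 2) = stdGaussian (PiLp 2 fun _ : ι => E) := by
  have := Measure.isProbabilityMeasure_map (μ := Measure.pi fun _ : ι => stdGaussian E)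
    (WithLp.measurable_toLp 2 (ι → E)).aemeasurable
  refine Measure.ext_of_charFun (funext fun t => ?_)
  rw [charFun_pi]
  simp_rw [charFun_stdGaussian, ← Complex.exp_sum, ← Complex.ofReal_pow]
  rw [PiLp.norm_sq_eq_of_L2, Complex.ofReal_sum, ← Finset.sum_neg_distrib, Finset.sum_div]

lemma stdGaussian_map_inner_orthonormalBasis {ι : Type*} [Fintype ι] {K : Submodule ℝ E}
    (v : OrthonormalBasis ι ℝ K) :
    (stdGaussian E).map (fun x i => ⟪(v i : E), x⟫) = Measure.pi fun _ : ι => gaussianReal 0 1 := by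
  have h : (stdGaussian E).map (fun x => toLp 2 (fun i => ⟪(v i : E), x⟫)) =
      stdGaussian (EuclideanSpace ℝ ι) := by
    refine stdGaussian_map_of_adjoint_isometry (M := fun t => (v.repr.symm t : E))
      (by fun_prop) (fun x t => ?_) (fun t => ?_)
    · rw [← v.sum_repr_symm, Submodule.coe_sum, inner_sum, PiLp.inner_apply]
      refine Finset.sum_congr rfl fun i _ => ?_
      rw [Submodule.coe_smul, real_inner_smul_right, real_inner_comm (v i : E) x]
      rfl
    · exact v.repr.symm.norm_map t
  rw [← map_pi_eq_stdGaussian] at h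
  have h2 := congrArg (Measure.map (ofLp (p := 2))) h
  rw [Measure.map_map (by fun_prop) (by fun_prop), Measure.map_map (by fun_prop) (by fun_prop)] at h2
  simpa [Function.comp_def] using h2

/-- Pairing with a nonzero normal vector of `K` gives a nondegenerate real Gaussian, which has no
atom at `0`. -/
lemma stdGaussian_submodule_eq_zero {K : Submodule ℝ E} (hK : K ≠ ⊤) :
    stdGaussian E K = 0 := by
  obtain ⟨v, hv, hv1⟩ : ∃ v ∈ Kᗮ, v ≠ 0 :=
    (Submodule.ne_bot_iff _).1 (by rwa [Ne, Submodule.orthogonal_eq_bot_iff])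
  have hvar : (Var[innerSL ℝ v; stdGaussian E]).toNNReal ≠ 0 := by
    rw [variance_dual_stdGaussian, innerSL_apply_norm]
    have := norm_pos_iff.2 hv1
    simpa using by positivity
  have h0 : (stdGaussian E).map (innerSL ℝ v) {0} = 0 := by
    have := nullSingletonClass_gaussianReal (μ := (stdGaussian E)[innerSL ℝ v]) hvar
    rw [IsGaussian.map_eq_gaussianReal]
    exact measure_singleton 0
  rw [Measure.map_apply (by fun_prop) (by simp)] at h0
  refine measure_mono_null (fun x hx => ?_) h0
  simpa using Submodule.inner_left_of_mem_orthogonal hx hv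

/-- Rational combinations are dense in the span, so the distance is a countable infimum of
measurable functions. Fubini needs this because the span itself varies. -/
lemma measurable_infDist_span {n : ℕ} : Measurable fun p : E × (Fin n → E) =>
    Metric.infDist p.1 (Submodule.span ℝ (Set.range p.2) : Set E) := by
  have h (p : E × (Fin n → E)) : Metric.infDist p.1 (Submodule.span ℝ (Set.range p.2) : Set E) =
      ⨅ c : Fin n → ℚ, dist p.1 (∑ i, (c i : ℝ) • p.2 i) := by
    have hd : DenseRange fun (c : Fin n → ℚ) i => (c i : ℝ) :=
      DenseRange.piMap fun _ => Rat.denseRange_cast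
    have hc : Continuous fun c : Fin n → ℝ => ∑ i, c i • p.2 i := by fun_prop
    have hr : (Submodule.span ℝ (Set.range p.2) : Set E) =
        Set.range fun c : Fin n → ℝ => ∑ i, c i • p.2 i := by
      ext x
      rw [SetLike.mem_coe, Submodule.mem_span_range_iff_exists_fun]
      rfl
    have hcl : closure (Submodule.span ℝ (Set.range p.2) : Set E) =
        closure (Set.range fun c : Fin n → ℚ => ∑ i, (c i : ℝ) • p.2 i) := by
      rw [hr]
      refine subset_antisymm (closure_minimal (hc.range_subset_closure_image_dense hd |>.trans ?_)
        isClosed_closure) (closure_mono ?_)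
      · rw [← Set.range_comp]
        rfl
      · rintro _ ⟨c, rfl⟩
        exact ⟨fun i => c i, rfl⟩
    rw [← Metric.infDist_closure, hcl, Metric.infDist_closure, Metric.infDist_eq_iInf,
      iInf_range' (fun y => dist p.1 y)]
  simp_rw [h]
  exact Measurable.iInf fun c => by fun_prop

lemma ae_notMem_span {n : ℕ} (h : n < Module.finrank ℝ E) :
    ∀ᵐ p : E × (Fin n → E) ∂((stdGaussian E).prod (Measure.pi fun _ : Fin n => stdGaussian E)),
      p.1 ∉ Submodule.span ℝ (Set.range p.2) := by
  refine ae_prod_of_ae_ae_symm (s := {p | p.1 ∉ Submodule.span ℝ (Set.range p.2)}) ?_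
    (ae_of_all _ fun w => ?_)
  · have : {p : E × (Fin n → E) | p.1 ∉ Submodule.span ℝ (Set.range p.2)} =
        (fun p => Metric.infDist p.1 (Submodule.span ℝ (Set.range p.2) : Set E)) ⁻¹' {0}ᶜ := by
      ext p
      exact ((Submodule.closed_of_finiteDimensional _).mem_iff_infDist_zero
        (Submodule.nonempty _)).not
    rw [this]
    exact measurable_infDist_span (measurableSet_singleton 0).compl
  · rw [ae_iff]
    simpa using stdGaussian_submodule_eq_zero (span_range_ne_top h w)

lemma ae_linearIndependent_pi_stdGaussian {n : ℕ} (h : n ≤ Module.finrank ℝ E) :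
    ∀ᵐ w ∂(Measure.pi fun _ : Fin n => stdGaussian E), LinearIndependent ℝ w := by
  induction n with
  | zero => exact ae_of_all _ fun w => linearIndependent_empty_type
  | succ n ih =>
    have hmp := measurePreserving_piFinSuccAbove (fun _ : Fin (n + 1) => stdGaussian E) 0
    have hsnd := Measure.quasiMeasurePreserving_snd (μ := stdGaussian E)
      (ν := Measure.pi fun _ : Fin n => stdGaussian E)
    filter_upwards [hmp.quasiMeasurePreserving.ae (hsnd.ae (ih (by omega))),
      hmp.quasiMeasurePreserving.ae (ae_notMem_span (Nat.lt_of_succ_le h))] with w hw1 hw2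
    rw [← Fin.cons_self_tail w, linearIndependent_finCons]
    exact ⟨hw1, hw2⟩

lemma stdGaussian_map_sq_norm_starProjection (K : Submodule ℝ E) {m : ℕ}
    (hm : Module.finrank ℝ K = m) :
    (stdGaussian E).map (fun x => ‖K.starProjection x‖ ^ 2) = chiSquared m := by
  subst hm
  let v := stdOrthonormalBasis ℝ K
  rw [chiSquared, ← stdGaussian_map_inner_orthonormalBasis v,
    Measure.map_map (by fun_prop) (by fun_prop)]
  congr 1
  ext x
  rw [Submodule.starProjection_apply, ← Submodule.coe_norm, ← v.sum_sq_norm_inner_right]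
  simp

/-- For almost every fixed `w` the span has dimension `n`, and the law of the squared distance does
not depend on `w`; integrating over `w` leaves it unchanged. -/
lemma hasLaw_sq_infDist_span {n : ℕ} (h : n ≤ Module.finrank ℝ E) :
    HasLaw (fun p : E × (Fin n → E) =>
        Metric.infDist p.1 (Submodule.span ℝ (Set.range p.2) : Set E) ^ 2)
      (chiSquared (Module.finrank ℝ E - n))
      ((stdGaussian E).prod (Measure.pi fun _ : Fin n => stdGaussian E)) where
  aemeasurable := (measurable_infDist_span.pow_const 2).aemeasurable
  map_eq := by
    have hmeas := (measurable_infDist_span (E := E) (n := n)).pow_const 2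
    ext s hs
    rw [Measure.map_apply hmeas hs, Measure.prod_apply_symm (hmeas hs)]
    have : ∀ᵐ w ∂(Measure.pi fun _ : Fin n => stdGaussian E),
        stdGaussian E ((fun x => (x, w)) ⁻¹' ((fun p : E × (Fin n → E) =>
          Metric.infDist p.1 (Submodule.span ℝ (Set.range p.2) : Set E) ^ 2) ⁻¹' s)) =
        chiSquared (Module.finrank ℝ E - n) s := by
      filter_upwards [ae_linearIndependent_pi_stdGaussian h] with w hw
      have hr : Module.finrank ℝ (Submodule.span ℝ (Set.range w))ᗮ = Module.finrank ℝ E - n := by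
        have h1 := Submodule.finrank_add_finrank_orthogonal (Submodule.span ℝ (Set.range w))
        have h2 := finrank_span_eq_card hw
        rw [Fintype.card_fin] at h2
        omega
      rw [← stdGaussian_map_sq_norm_starProjection _ hr, Measure.map_apply (by fun_prop) hs]
      simp only [← infDist_eq_norm_starProjection_orthogonal]
      rfl
    rw [lintegral_congr_ae this]
    simp

end StdGaussian

/-- The point of least norm on the affine subspace `{y ∈ Kᗮ | ⟪x, y⟫ = c}`. -/
lemma isMinNormIn_iff {d : ℕ} {S : Set (EuclideanSpace ℝ (Fin d))}
    {K : Submodule ℝ (EuclideanSpace ℝ (Fin d))} {x : EuclideanSpace ℝ (Fin d)} {c : ℝ}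
    (hx : x ∉ K) (hS : ∀ y, y ∈ S ↔ ⟪x, y⟫ = c ∧ y ∈ Kᗮ) (y : EuclideanSpace ℝ (Fin d)) :
    IsMinNormIn S y ↔ y = (c / ‖Kᗮ.starProjection x‖ ^ 2) • Kᗮ.starProjection x := by
  set p := Kᗮ.starProjection x with hp
  have hp0 : p ≠ 0 := by
    rw [hp, Ne, Submodule.starProjection_apply_eq_zero_iff]
    simpa using hx
  have hpn : ‖p‖ ≠ 0 := norm_ne_zero_iff.2 hp0
  have hpK : p ∈ Kᗮ := Submodule.starProjection_apply_mem _ _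
  have hinner : ∀ z ∈ Kᗮ, ⟪x, z⟫ = ⟪p, z⟫ := fun z hz => by
    rw [hp, Submodule.inner_starProjection_left_eq_right, Submodule.starProjection_eq_self_iff.2 hz]
  set q := (c / ‖p‖ ^ 2) • p with hq
  have hqS : q ∈ S := by
    refine (hS q).2 ⟨?_, Submodule.smul_mem _ _ hpK⟩
    rw [hinner q (Submodule.smul_mem _ _ hpK), hq, real_inner_smul_right,
      real_inner_self_eq_norm_sq]
    field_simp
  -- Pythagoras: `q` is parallel to `p`, and all points of `S` have the same inner product with `p`.
  have hpyth : ∀ w ∈ S, ‖w‖ ^ 2 = ‖q‖ ^ 2 + ‖w - q‖ ^ 2 := fun w hw => by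
    have hqS' := (hS q).1 hqS
    have hw' := (hS w).1 hw
    have : ⟪q, w - q⟫ = 0 := by
      rw [hq, real_inner_smul_left, ← hq, inner_sub_right, ← hinner w hw'.2, ← hinner q hqS'.2,
        hw'.1, hqS'.1, sub_self, mul_zero]
    have h2 := norm_add_sq_real q (w - q)
    rw [this, add_sub_cancel] at h2
    linarith
  constructor
  · rintro ⟨hy, hmin⟩
    have h1 := hpyth y hy
    have h2 := pow_le_pow_left₀ (norm_nonneg _) (hmin q hqS) 2
    have h3 : ‖y - q‖ ^ 2 = 0 := le_antisymm (by linarith) (by positivity)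
    exact sub_eq_zero.1 (norm_eq_zero.1 (pow_eq_zero_iff two_ne_zero |>.1 h3))
  · rintro rfl
    refine ⟨hqS, fun w hw => ?_⟩
    refine pow_le_pow_iff_left₀ (norm_nonneg _) (norm_nonneg _) two_ne_zero |>.1 ?_
    rw [hpyth w hw]
    exact le_add_of_nonneg_right (by positivity)

/-! ### Gaussian matrices and the solution set. -/

lemma IsGaussianMatrix.hasLaw_toLp {Ω : Type*} [MeasurableSpace Ω] {P : Measure Ω}
    [IsProbabilityMeasure P] {D d : ℕ} {A : Ω → Matrix (Fin D) (Fin d) ℝ}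
    (hA : IsGaussianMatrix P A) :
    HasLaw (fun ω => toLp 2 fun p : Fin D × Fin d => A ω p.1 p.2)
      (stdGaussian (EuclideanSpace ℝ (Fin D × Fin d))) P := by
  have h1 := hA.iIndepFun_entries.hasLaw_pi fun p : Fin D × Fin d => hA.hasLaw_entry p.1 p.2
  have h2 : HasLaw (toLp 2) (stdGaussian (EuclideanSpace ℝ (Fin D × Fin d)))
      (Measure.pi fun _ : Fin D × Fin d => gaussianReal 0 1) :=
    ⟨by fun_prop, map_pi_eq_stdGaussian⟩
  exact h2.comp h1

/-- The vectors `Aᵀ uᵢ`, for orthonormal `uᵢ`, are independent standard Gaussian vectors. -/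
lemma IsGaussianMatrix.hasLaw_transpose_orthonormal {Ω : Type*} [MeasurableSpace Ω]
    {P : Measure Ω} [IsProbabilityMeasure P] {D d : ℕ} {A : Ω → Matrix (Fin D) (Fin d) ℝ}
    (hA : IsGaussianMatrix P A) {ι : Type*} [Fintype ι] {u : ι → EuclideanSpace ℝ (Fin D)}
    (hu : Orthonormal ℝ u) :
    HasLaw (fun ω i => Matrix.toEuclideanLin (A ω).transpose (u i))
      (Measure.pi fun _ : ι => stdGaussian (EuclideanSpace ℝ (Fin d))) P := by
  have hL : (stdGaussian (EuclideanSpace ℝ (Fin D × Fin d))).map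
      (fun X => toLp 2 fun i : ι => toLp 2 fun j : Fin d => ∑ k, u i k * X (k, j)) =
      stdGaussian (PiLp 2 fun _ : ι => EuclideanSpace ℝ (Fin d)) := by
    -- The adjoint of `X ↦ (Xᵀ uᵢ)ᵢ` is `t ↦ ∑ᵢ uᵢ tᵢᵀ`, isometric because the `uᵢ` are orthonormal.
    refine stdGaussian_map_of_adjoint_isometry
      (M := fun t => toLp 2 fun p : Fin D × Fin d => ∑ i, t i p.2 * u i p.1)
      (by fun_prop) (fun X t => ?_) (fun t => ?_)
    · simp only [PiLp.inner_apply, RCLike.inner_apply, conj_trivial, Fintype.sum_prod_type,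
        Finset.mul_sum, Finset.sum_mul]
      refine Finset.sum_comm.trans (Eq.trans (Finset.sum_congr rfl fun j _ =>
        Finset.sum_comm.trans ?_) Finset.sum_comm)
      exact Finset.sum_congr rfl fun k _ => Finset.sum_congr rfl fun i _ => (mul_assoc _ _ _).symm
    · refine (pow_left_inj₀ (norm_nonneg _) (norm_nonneg _) two_ne_zero).1 ?_
      have hj (j : Fin d) : ∑ k, (∑ i, t i j * u i k) ^ 2 = ∑ i, t i j ^ 2 := by
        have h : ‖∑ i, t i j • u i‖ ^ 2 = ∑ i, t i j ^ 2 := by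
          rw [← real_inner_self_eq_norm_sq, hu.inner_sum]
          simp [pow_two]
        rw [← h, EuclideanSpace.real_norm_sq_eq]
        simp
      rw [EuclideanSpace.real_norm_sq_eq, PiLp.norm_sq_eq_of_L2, Fintype.sum_prod_type,
        Finset.sum_comm]
      simp_rw [hj, EuclideanSpace.real_norm_sq_eq]
      exact Finset.sum_comm
  have h1 : HasLaw ofLp (Measure.pi fun _ : ι => stdGaussian (EuclideanSpace ℝ (Fin d)))
      (stdGaussian (PiLp 2 fun _ : ι => EuclideanSpace ℝ (Fin d))) := by
    refine ⟨by fun_prop, ?_⟩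
    rw [← map_pi_stdGaussian, Measure.map_map (by fun_prop) (by fun_prop)]
    exact Measure.map_id
  have h2 := (h1.comp ⟨by fun_prop, hL⟩).comp hA.hasLaw_toLp
  convert h2 using 3 with ω i
  ext j
  simp [Matrix.toLpLin_apply, Matrix.mulVec, dotProduct, mul_comm]

lemma inner_toEuclideanLin_transpose {D d : ℕ} (B : Matrix (Fin D) (Fin d) ℝ)
    (u : EuclideanSpace ℝ (Fin D)) (y : EuclideanSpace ℝ (Fin d)) :
    ⟪Matrix.toEuclideanLin B.transpose u, y⟫ = ⟪u, Matrix.toEuclideanLin B y⟫ := by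
  rw [← Matrix.conjTranspose_eq_transpose_of_trivial, Matrix.toEuclideanLin_conjTranspose_eq_adjoint,
    LinearMap.adjoint_inner_left]

lemma mem_affineComponent_iff {D : ℕ} {T : Submodule ℝ (EuclideanSpace ℝ (Fin D))}
    {x z : EuclideanSpace ℝ (Fin D)} :
    z ∈ affineComponent T x ↔ z - topComponent T x ∈ Tᗮ :=
  ⟨fun ⟨v, hv, h⟩ => by simpa [h] using hv, fun h => ⟨_, h, by abel⟩⟩

/-- A nonzero vector of `T` is a positive multiple of the first vector of some orthonormal basis. -/
lemma exists_orthonormalBasis_zero_smul {E : Type*} [NormedAddCommGroup E] [InnerProductSpace ℝ E]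
    [FiniteDimensional ℝ E] {n : ℕ} (h : Module.finrank ℝ E = n + 1) {x : E} (hx : x ≠ 0) :
    ∃ v : OrthonormalBasis (Fin (n + 1)) ℝ E, x = ‖x‖ • v 0 := by
  have hpos : ‖x‖ ≠ 0 := norm_ne_zero_iff.2 hx
  obtain ⟨v, hv⟩ := Orthonormal.exists_orthonormalBasis_extension_of_card_eq (𝕜 := ℝ)
    (ι := Fin (n + 1)) (by simpa using h) (v := fun _ => ‖x‖⁻¹ • x) (s := {0})
    ⟨fun _ => by simp [norm_smul, hpos],
      fun i j hij => (hij (Subsingleton.elim i j)).elim⟩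
  refine ⟨v, ?_⟩
  rw [hv 0 rfl, smul_smul, mul_inv_cancel₀ hpos, one_smul]

lemma mem_reducedSolutions_iff {D d n : ℕ} {T : Submodule ℝ (EuclideanSpace ℝ (Fin D))}
    {x : EuclideanSpace ℝ (Fin D)} (v : OrthonormalBasis (Fin (n + 1)) ℝ T)
    (hv : topComponent T x = ‖topComponent T x‖ • (v 0 : EuclideanSpace ℝ (Fin D)))
    (B : Matrix (Fin D) (Fin d) ℝ) (y : EuclideanSpace ℝ (Fin d)) :
    y ∈ reducedSolutions B (affineComponent T x) ↔
      ⟪Matrix.toEuclideanLin B.transpose (v 0), y⟫ = ‖topComponent T x‖ ∧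
      y ∈ (Submodule.span ℝ (Set.range fun i : Fin n =>
        Matrix.toEuclideanLin B.transpose (v i.succ)))ᗮ := by
  have hT (z : EuclideanSpace ℝ (Fin D)) : z ∈ Tᗮ ↔ ∀ i, ⟪(v i : EuclideanSpace ℝ (Fin D)), z⟫ = 0 := by
    refine ⟨fun h i => h _ (v i).2, fun h w hw => ?_⟩
    have := congrArg Subtype.val (v.sum_repr ⟨w, hw⟩)
    simp only [Submodule.coe_sum, Submodule.coe_smul] at this
    rw [← this, sum_inner]
    exact Finset.sum_eq_zero fun i _ => by rw [real_inner_smul_left, h, mul_zero]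
  have hon : Orthonormal ℝ fun i => (v i : EuclideanSpace ℝ (Fin D)) :=
    v.orthonormal.comp_linearIsometry T.subtypeₗᵢ
  have hin (i) : ⟪(v i : EuclideanSpace ℝ (Fin D)), topComponent T x⟫ =
      ‖topComponent T x‖ * if i = 0 then 1 else 0 := by
    conv_lhs => rw [hv, real_inner_smul_right, orthonormal_iff_ite.1 hon]
  change Matrix.toEuclideanLin B y ∈ affineComponent T x ↔ _
  rw [mem_affineComponent_iff, hT, Fin.forall_fin_succ]
  simp only [inner_sub_right, hin, ← inner_toEuclideanLin_transpose, sub_eq_zero, Fin.succ_ne_zero,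
    if_true, if_false, mul_one, mul_zero]
  refine and_congr Iff.rfl ?_
  rw [Submodule.mem_orthogonal]
  refine ⟨fun h w hw => ?_, fun h i => h _ (Submodule.subset_span ⟨i, rfl⟩)⟩
  induction hw using Submodule.span_induction with
  | mem w hw => obtain ⟨i, rfl⟩ := hw; exact h i
  | zero => exact inner_zero_left _
  | add a b _ _ ha hb => rw [inner_add_left, ha, hb, add_zero]
  | smul c a _ ha => rw [real_inner_smul_left, ha, mul_zero]

end RandomEmbedding

end

open RandomEmbedding

theorem mainTheorem1 {Ω : Type*} [MeasurableSpace Ω] (P : Measure Ω) [IsProbabilityMeasure P]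
    (D d de : ℕ) (hde : de ≤ d)
    (f : EuclideanSpace ℝ (Fin D) → ℝ) (hf : Continuous f)
    (T : Submodule ℝ (EuclideanSpace ℝ (Fin D)))
    (hT : RandomEmbedding.HasEffectiveSubspace f de T)
    (xstar : EuclideanSpace ℝ (Fin D)) (hmin : ∀ x, f xstar ≤ f x)
    (hne : RandomEmbedding.topComponent T xstar ≠ 0)
    (A : Ω → Matrix (Fin D) (Fin d) ℝ) (hA : RandomEmbedding.IsGaussianMatrix P A) :
    (∀ᵐ ω ∂P, ∃! y : EuclideanSpace ℝ (Fin d), RandomEmbedding.IsMinNormIn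
      (RandomEmbedding.reducedSolutions (A ω) (RandomEmbedding.affineComponent T xstar)) y) ∧
    ∀ y2 : Ω → EuclideanSpace ℝ (Fin d),
      (∀ᵐ ω ∂P, RandomEmbedding.IsMinNormIn
        (RandomEmbedding.reducedSolutions (A ω) (RandomEmbedding.affineComponent T xstar))
        (y2 ω)) →
      HasLaw (fun ω => ‖RandomEmbedding.topComponent T xstar‖ ^ 2 / ‖y2 ω‖ ^ 2)
        (RandomEmbedding.chiSquared (d - de + 1)) P := by
  have hxT : topComponent T xstar ∈ T := Submodule.starProjection_apply_mem _ _
  -- `T` contains a nonzero vector, so `de` is positive.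
  obtain ⟨n, rfl⟩ : ∃ n, de = n + 1 := by
    refine Nat.exists_eq_succ_of_ne_zero fun h0 => hne ?_
    have := hT.finrank_eq.trans h0
    rw [Submodule.finrank_eq_zero] at this
    exact (Submodule.mem_bot ℝ).1 (this ▸ hxT)
  obtain ⟨v, hv⟩ := exists_orthonormalBasis_zero_smul hT.finrank_eq
    (x := (⟨topComponent T xstar, hxT⟩ : T)) (by simpa using hne)
  replace hv : topComponent T xstar = ‖topComponent T xstar‖ •
    (v 0 : EuclideanSpace ℝ (Fin D)) := congrArg Subtype.val hv
  set c := ‖topComponent T xstar‖ with hc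
  have hc0 : c ≠ 0 := norm_ne_zero_iff.2 hne
  have hon : Orthonormal ℝ fun i => (v i : EuclideanSpace ℝ (Fin D)) :=
    v.orthonormal.comp_linearIsometry T.subtypeₗᵢ
  have hlaw := (measurePreserving_piFinSuccAbove
    (fun _ : Fin (n + 1) => stdGaussian (EuclideanSpace ℝ (Fin d))) 0).comp_hasLaw
    (hA.hasLaw_transpose_orthonormal hon)
  have hrank : Module.finrank ℝ (EuclideanSpace ℝ (Fin d)) = d := finrank_euclideanSpace_fin
  let K : Ω → Submodule ℝ (EuclideanSpace ℝ (Fin d)) := fun ω =>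
    Submodule.span ℝ (Set.range fun i : Fin n =>
        Matrix.toEuclideanLin (A ω).transpose (v i.succ : EuclideanSpace ℝ (Fin D)))
  let b : Ω → EuclideanSpace ℝ (Fin d) := fun ω =>
    Matrix.toEuclideanLin (A ω).transpose (v 0 : EuclideanSpace ℝ (Fin D))
  have hb : ∀ᵐ ω ∂P, b ω ∉ K ω :=
    ae_of_ae_map hlaw.aemeasurable
      (hlaw.map_eq ▸ ae_notMem_span (E := EuclideanSpace ℝ (Fin d)) (n := n) (by omega))
  have hiff : ∀ᵐ ω ∂P, b ω ∉ K ω ∧ ∀ y, IsMinNormIn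
      (reducedSolutions (A ω) (affineComponent T xstar)) y ↔
      y = (c / ‖(K ω)ᗮ.starProjection (b ω)‖ ^ 2) • (K ω)ᗮ.starProjection (b ω) := by
    filter_upwards [hb] with ω hω
    exact ⟨hω, isMinNormIn_iff hω (mem_reducedSolutions_iff v hv (A ω))⟩
  refine ⟨?_, fun y2 hy2 => ?_⟩
  · filter_upwards [hiff] with ω hω
    simp only [hω.2, existsUnique_eq]
  · have hchi := (hasLaw_sq_infDist_span (E := EuclideanSpace ℝ (Fin d)) (n := n)
      (by omega)).comp hlaw
    -- Natural subtraction is harmless here since `n + 1 ≤ d`.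
    rw [hrank, show d - n = d - (n + 1) + 1 by omega] at hchi
    refine hchi.congr ?_
    filter_upwards [hiff, hy2] with ω hω hyω
    change _ = Metric.infDist (b ω) (K ω) ^ 2
    rw [infDist_eq_norm_starProjection_orthogonal, (hω.2 _).1 hyω]
    have hp : ‖(K ω)ᗮ.starProjection (b ω)‖ ≠ 0 := by
      rw [← infDist_eq_norm_starProjection_orthogonal]
      exact fun h => hω.1 (((Submodule.closed_of_finiteDimensional _).mem_iff_infDist_zero
        (Submodule.nonempty _)).2 h)
    -- The minimizer has norm `c / ‖p‖`, so `c` cancels from the ratio.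
    rw [norm_smul, norm_div, norm_pow, norm_norm, Real.norm_eq_abs, hc, abs_norm, ← hc]
    field_simp
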